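/- Let $0<\sigma<1$ and let $\Omega_\sigma=\{\sigma,-\sigma\}^{\mathbb Z}$. For $c\in\Omega_\sigma$ let $A_c$ be the bounded operator on the complex Hilbert space $\ell^2(\mathbb Z)$ given by $$(A_cf)_n=c_nf_{n-1}+f_{n+1}\qquad(n\in\mathbb Z).$$ Call $c\in\Omega_\sigma$ pseudo-ergodic if for every finite sequence $b_1,\dots,b_n\in\{\sigma,-\sigma\}$ there is $m\in\mathbb Z$ with $c_{m+r}=b_r$ for $1\le r\le n$. Let $$E_{\pm\sigma}=\Big\{x+iy:\frac{x^2}{(1\pm\sigma)^2}+\frac{y^2}{(1\mp\sigma)^2}<1\Big\},\qquad H_\sigma=E_\sigma\cap E_{-\sigma}.$$ Then pseudo-ergodic sequences $c\in\Omega_\sigma$ exist, and the spectrum of $A_c$ is the same set $S_\sigma$ for all of them. If $0<p<1$ and the entries $c_n$ are independent with $\Pr(c_n=\sigma)=p$ and $\Pr(c_n=-\sigma)=1-p$, then almost surely $c$ is pseudo-ergodic and the spectrum of $A_c$ is $S_\sigma$. Moreover $$\{\lambda\in\mathbb C:|\lambda|\le 1\}\setminus H_\sigma\subseteq S_\sigma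 .$$ -/

import Mathlib

open MeasureTheory
open scoped ENNReal

noncomputable section

namespace HoppingMatrix

/-- The sequence space `Ω_σ = {σ, -σ}^ℤ`. -/
abbrev Omega (σ : ℝ) : Type := ℤ → ({σ, -σ} : Set ℝ)

/-- The complex Hilbert space `ℓ²(ℤ)`. -/
abbrev L2Z : Type := lp (fun _ : ℤ => ℂ) 2

theorem memlp_shift (k : ℤ) (f : L2Z) : Memℓp (fun n : ℤ => f (n + k)) 2 := by
  have hp : 0 < (2 : ℝ≥0∞).toReal := by norm_num
  rw [memℓp_gen_iff hp]
  exact ((lp.memℓp f).summable hp).comp_injective (add_left_injective k)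

theorem norm_shift (k : ℤ) (f : L2Z) : ‖(⟨_, memlp_shift k f⟩ : L2Z)‖ = ‖f‖ := by
  have hp : 0 < (2 : ℝ≥0∞).toReal := by norm_num
  rw [lp.norm_eq_tsum_rpow hp, lp.norm_eq_tsum_rpow hp]
  congr 1
  exact (Equiv.addRight k).tsum_eq (fun n : ℤ => ‖f n‖ ^ (2 : ℝ≥0∞).toReal)

theorem abs_entry {σ : ℝ} (c : Omega σ) (n : ℤ) : |(c n : ℝ)| = |σ| := by
  rcases (c n).2 with h | h
  · rw [h]
  · rw [Set.mem_singleton_iff.1 h, abs_neg]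

theorem norm_entry_mul_le {σ : ℝ} (c : Omega σ) (n : ℤ) (z : ℂ) :
    ‖((c n : ℝ) : ℂ) * z‖ ≤ ‖(σ : ℂ) * z‖ := by
  simp [abs_entry c n]

theorem memlp_weighted_shift {σ : ℝ} (c : Omega σ) (f : L2Z) :
    Memℓp (fun n : ℤ => ((c n : ℝ) : ℂ) * f (n - 1)) 2 :=
  ((memlp_shift (-1) f).const_mul (σ : ℂ)).mono' fun n => norm_entry_mul_le c n _

theorem norm_weighted_shift_le {σ : ℝ} (c : Omega σ) (f : L2Z) :
    ‖(⟨_, memlp_weighted_shift c f⟩ : L2Z)‖ ≤ |σ| * ‖f‖ := by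
  have h := lp.norm_mono (p := 2) (by norm_num)
    (x := (⟨_, memlp_weighted_shift c f⟩ : L2Z))
    (y := (σ : ℂ) • (⟨_, memlp_shift (-1) f⟩ : L2Z))
    fun n => norm_entry_mul_le c n _
  rw [norm_smul, norm_shift] at h
  simpa using h

/-- The bounded operator on `ℓ²(ℤ)` with the tridiagonal matrix whose `n`-th row has entry `c n`
in column `n - 1`, entry `0` in column `n` and entry `1` in column `n + 1`:
`(A_c f) n = c n * f (n - 1) + f (n + 1)`. -/
def hoppingOperator {σ : ℝ} (c : Omega σ) : L2Z →L[ℂ] L2Z :=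
  LinearMap.mkContinuous
    { toFun := fun f =>
        ⟨fun n : ℤ => ((c n : ℝ) : ℂ) * f (n - 1) + f (n + 1),
          (memlp_weighted_shift c f).add (memlp_shift 1 f)⟩
      map_add' := fun f g => by
        ext n
        simp only [lp.coeFn_add, Pi.add_apply]
        ring
      map_smul' := fun a f => by
        ext n
        simp only [lp.coeFn_smul, Pi.smul_apply, smul_eq_mul, RingHom.id_apply]
        ring }
    (|σ| + 1)
    (fun f => by
      rw [add_mul, one_mul]
      have h := norm_add_le (⟨_, memlp_weighted_shift c f⟩ : L2Z) ⟨_, memlp_shift 1 f⟩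
      rw [norm_shift] at h
      exact h.trans (add_le_add (norm_weighted_shift_le c f) le_rfl))

@[simp]
theorem hoppingOperator_apply {σ : ℝ} (c : Omega σ) (f : L2Z) (n : ℤ) :
    hoppingOperator c f n = ((c n : ℝ) : ℂ) * f (n - 1) + f (n + 1) := rfl

/-- `Spec (A_c)`, for `A_c` as a bounded operator on `ℓ²(ℤ)`. -/
def spec {σ : ℝ} (c : Omega σ) : Set ℂ := spectrum ℂ (hoppingOperator c)

/-- `c ∈ Ω_σ` is pseudo-ergodic if every finite sequence of elements of `{σ, -σ}` occurs as a block
of consecutive terms of `c`. The entry `b r` with `r : Fin n` is the `(r + 1)`-st term of `b`. -/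
def PseudoErgodic {σ : ℝ} (c : Omega σ) : Prop :=
  ∀ (n : ℕ) (b : Fin n → ({σ, -σ} : Set ℝ)), ∃ m : ℤ, ∀ r : Fin n, c (m + ((r : ℕ) + 1)) = b r

/-- `S_σ`, the common spectrum of the operators `A_c` with `c ∈ Ω_σ` pseudo-ergodic, written as the
intersection of these spectra. -/
def commonSpectrum (σ : ℝ) : Set ℂ := ⋂ (c : Omega σ) (_ : PseudoErgodic c), spec c

/-- The law on `{σ, -σ}` of one entry: `σ` has probability `p` and `-σ` has probability `1 - p`. -/
def entryLaw (σ p : ℝ) : Measure ({σ, -σ} : Set ℝ) :=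
  ENNReal.ofReal p • Measure.dirac ⟨σ, Or.inl rfl⟩ +
    ENNReal.ofReal (1 - p) • Measure.dirac ⟨-σ, Or.inr rfl⟩

theorem isProbabilityMeasure_entryLaw {σ p : ℝ} (h0 : 0 ≤ p) (h1 : p ≤ 1) :
    IsProbabilityMeasure (entryLaw σ p) := by
  constructor
  simp only [entryLaw, Measure.add_apply, Measure.smul_apply, measure_univ, smul_eq_mul, mul_one]
  rw [← ENNReal.ofReal_add h0 (by linarith)]
  simp

/-- The product measure on `Ω_σ` under which the entries `c n` are independent with law
`entryLaw σ p`. -/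
def sequenceLaw (σ p : ℝ) : Measure (Omega σ) := Measure.infinitePi fun _ : ℤ => entryLaw σ p

/-- The open elliptical region `x² / (1 + τ)² + y² / (1 - τ)² < 1`. -/
def ellipse (τ : ℝ) : Set ℂ := {z | z.re ^ 2 / (1 + τ) ^ 2 + z.im ^ 2 / (1 - τ) ^ 2 < 1}

/-- `H_σ = E_σ ∩ E_{-σ}`. -/
def hole (σ : ℝ) : Set ℂ := ellipse σ ∩ ellipse (-σ)

end HoppingMatrix

end

/-! Let `s = ±σ` and let `w` lie outside `ellipse s`. Then `w = z + s / z` with `|z| ≥ 1`, and `z ^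
n` solves the eigenvalue equation with constant coefficients `s` and stays bounded as `n → -∞`. On
the right half-line, if `|w| < 1`, the signs can be chosen so that every solution is bounded
(`exists_bounded_recurrence`): for suitably paired signs the even-indexed terms solve a recurrence
of the same kind with `w ^ 2`, `σ ^ 2`, and after enough doublings the sum of the two moduli is at
most `1`. Gluing the halves gives a bounded eigenfunction of some `A_d`, so `w ∈ spec d`
(`IsBoundedEigenfunction.mem_spec`).

If `c` is pseudo-ergodic, `spec c` contains every `spec d`: invertibility amounts to lower bounds
for `A_c - w` and its adjoint, and a finitely supported vector tests only a finite block of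
coefficients, which occurs in `c`. This also makes `spec c` independent of `c`. Closedness of the
spectrum and constant sequences handle `|w| = 1`. The second Borel–Cantelli lemma gives
pseudo-ergodicity almost surely, hence existence. -/

noncomputable section

namespace HoppingMatrix

open Filter Topology

/-! ### Bounded solutions on a half-line by period doubling. -/

section Recurrence

/-- Every solution of `f (n + 2) = w f (n + 1) - c n f n` is bounded if `|w| + sup |c n| ≤ 1`. -/
theorem bounded_of_contraction {σ : ℝ} {w : ℂ} (h : ‖w‖ + σ ≤ 1) (c : ℕ → ℝ)
    (hc : ∀ n, |c n| = σ) (f : ℕ → ℂ) (hf : ∀ n, f (n + 2) = w * f (n + 1) - c n * f n) :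
    ∃ M, ∀ n, ‖f n‖ ≤ M := by
  refine ⟨max ‖f 0‖ ‖f 1‖, fun n => ?_⟩
  suffices H : ‖f n‖ ≤ max ‖f 0‖ ‖f 1‖ ∧ ‖f (n + 1)‖ ≤ max ‖f 0‖ ‖f 1‖ from H.1
  induction n with
  | zero => exact ⟨le_max_left _ _, le_max_right _ _⟩
  | succ n ih =>
    refine ⟨ih.2, ?_⟩
    set M := max ‖f 0‖ ‖f 1‖
    have hM : 0 ≤ M := (norm_nonneg _).trans ih.1
    rw [show n + 1 + 1 = n + 2 from rfl, hf]
    have hσ : 0 ≤ σ := hc 0 ▸ abs_nonneg _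
    calc ‖w * f (n + 1) - c n * f n‖ ≤ ‖w‖ * ‖f (n + 1)‖ + σ * ‖f n‖ := by
          refine (norm_sub_le _ _).trans_eq ?_
          rw [norm_mul, norm_mul, Complex.norm_real, Real.norm_eq_abs, hc]
      _ ≤ ‖w‖ * M + σ * M := by gcongr <;> [exact ih.2; exact ih.1]
      _ = (‖w‖ + σ) * M := by ring
      _ ≤ 1 * M := by gcongr
      _ = M := one_mul M

/-- The coefficients with even index in the period-doubling construction. -/
def doublingSeq (σ : ℝ) (b : ℕ → ℝ) : ℕ → ℝ
  | 0 => σ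
  | n + 1 => -(b n / doublingSeq σ b n)

theorem abs_doublingSeq {σ : ℝ} (hσ : 0 < σ) {b : ℕ → ℝ} (hb : ∀ n, |b n| = σ ^ 2) (n : ℕ) :
    |doublingSeq σ b n| = σ := by
  induction n with
  | zero => exact abs_of_pos hσ
  | succ n ih =>
    rw [doublingSeq, abs_neg, abs_div, hb, ih]
    field_simp

/-- If all solutions of a recurrence with parameters `σ ^ 2`, `w ^ 2` are bounded, then so are all
solutions of some recurrence with parameters `σ`, `w`. -/
theorem exists_bounded_of_sq {σ : ℝ} (hσ : 0 < σ) {w : ℂ} (hw : w ≠ 0) {b : ℕ → ℝ}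
    (hb : ∀ n, |b n| = σ ^ 2)
    (hbdd : ∀ g : ℕ → ℂ, (∀ n, g (n + 2) = w ^ 2 * g (n + 1) - b n * g n) →
      ∃ M, ∀ n, ‖g n‖ ≤ M) :
    ∃ c : ℕ → ℝ, (∀ n, |c n| = σ) ∧
      ∀ f : ℕ → ℂ, (∀ n, f (n + 2) = w * f (n + 1) - c n * f n) → ∃ M, ∀ n, ‖f n‖ ≤ M := by
  set e := doublingSeq σ b
  have hea : ∀ n, |e n| = σ := abs_doublingSeq hσ hb
  have he0 : ∀ n, (e n : ℂ) ≠ 0 := fun n => by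
    rw [Complex.ofReal_ne_zero, ← abs_pos, hea]
    exact hσ
  have hes : ∀ n, (b n : ℂ) = -(e (n + 1) * e n) := fun n => by
    have : e (n + 1) = -(b n / e n) := rfl
    rw [this]
    push_cast
    field_simp [he0 n]
  -- The coefficients at `2n + 1` and `2n + 2` are opposite, which cancels the extra middle term
  -- when the odd-indexed values of `f` are eliminated.
  refine ⟨fun n => if Even n then e (n / 2) else -e (n / 2 + 1), fun n => ?_, fun f hf => ?_⟩
  · dsimp only
    split_ifs <;> simp [hea]
  have h0 : ∀ n, f (2 * n + 2) = w * f (2 * n + 1) - e n * f (2 * n) := fun n => by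
    rw [hf]
    simp
  have h1 : ∀ n, f (2 * n + 3) = w * f (2 * n + 2) + e (n + 1) * f (2 * n + 1) := fun n => by
    have hodd : ¬ Even (2 * n + 1) := by simp
    have hdiv : (2 * n + 1) / 2 = n := by omega
    have := hf (2 * n + 1)
    simp only [hodd, if_false, hdiv] at this
    rw [show 2 * n + 3 = 2 * n + 1 + 2 by ring, this]
    push_cast
    ring
  obtain ⟨M, hM⟩ := hbdd (fun n => f (2 * n)) fun n => by
    have h2 := h0 (n + 1)
    have h3 := h1 n
    have h4 := h0 n
    simp only [show 2 * (n + 1) = 2 * n + 2 by ring, show 2 * (n + 2) = 2 * n + 4 by ring] at *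
    rw [hes, h2]
    linear_combination w * h3 - (e (n + 1) : ℂ) * h4
  have hM0 : 0 ≤ M := (norm_nonneg _).trans (hM 0)
  have hw' : 0 < ‖w‖ := norm_pos_iff.2 hw
  -- Odd-indexed values are recovered from `w f(2k+1) = f(2k+2) + e_k f(2k)`; this needs `w ≠ 0`.
  refine ⟨M + (M + σ * M) / ‖w‖, fun n => ?_⟩
  obtain ⟨k, rfl | rfl⟩ := Nat.even_or_odd' n
  · exact (hM k).trans (le_add_of_nonneg_right (by positivity))
  · refine le_trans ?_ (le_add_of_nonneg_left hM0)
    rw [le_div_iff₀ hw', mul_comm, ← norm_mul,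
      show w * f (2 * k + 1) = f (2 * (k + 1)) + e k * f (2 * k) by
        rw [show 2 * (k + 1) = 2 * k + 2 by ring, h0]; ring]
    refine (norm_add_le _ _).trans (add_le_add (hM _) ?_)
    rw [norm_mul, Complex.norm_real, Real.norm_eq_abs, hea]
    exact mul_le_mul_of_nonneg_left (hM k) hσ.le

/-- For `|w| < 1` some choice of signs makes all solutions of the recurrence bounded. -/
theorem exists_bounded_recurrence {σ : ℝ} (hσ0 : 0 < σ) (hσ1 : σ < 1) {w : ℂ} (hw : ‖w‖ < 1) :
    ∃ c : ℕ → ℝ, (∀ n, |c n| = σ) ∧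
      ∀ f : ℕ → ℂ, (∀ n, f (n + 2) = w * f (n + 1) - c n * f n) → ∃ M, ∀ n, ‖f n‖ ≤ M := by
  have base : ∀ {σ : ℝ} {w : ℂ}, 0 < σ → ‖w‖ + σ ≤ 1 → ∃ c : ℕ → ℝ, (∀ n, |c n| = σ) ∧
      ∀ f : ℕ → ℂ, (∀ n, f (n + 2) = w * f (n + 1) - c n * f n) → ∃ M, ∀ n, ‖f n‖ ≤ M :=
    fun {σ w} hσ h => ⟨fun _ => σ, fun _ => abs_of_pos hσ,
      bounded_of_contraction h _ fun _ => abs_of_pos hσ⟩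
  have step : ∀ (k : ℕ) (σ : ℝ) (w : ℂ), 0 < σ → σ < 1 → ‖w‖ ^ 2 ^ k + σ ^ 2 ^ k ≤ 1 →
      ∃ c : ℕ → ℝ, (∀ n, |c n| = σ) ∧
        ∀ f : ℕ → ℂ, (∀ n, f (n + 2) = w * f (n + 1) - c n * f n) → ∃ M, ∀ n, ‖f n‖ ≤ M := by
    intro k
    induction k with
    | zero => exact fun σ w h0 _ h => base h0 (by simpa using h)
    | succ k ih =>
      intro σ w h0 h1 h
      rcases eq_or_ne w 0 with rfl | hw
      · exact base h0 (by simpa using h1.le)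
      obtain ⟨b, hb, hbdd⟩ := ih (σ ^ 2) (w ^ 2) (by positivity) (by nlinarith) (by
        rwa [norm_pow, ← pow_mul, ← pow_mul, ← pow_succ'])
      exact exists_bounded_of_sq h0 hw hb hbdd
  have hlim : Tendsto (fun k : ℕ => ‖w‖ ^ 2 ^ k + σ ^ 2 ^ k) atTop (𝓝 (0 + 0)) := by
    have h2 : Tendsto (fun k : ℕ => 2 ^ k) atTop atTop :=
      tendsto_pow_atTop_atTop_of_one_lt one_lt_two
    exact ((tendsto_pow_atTop_nhds_zero_of_lt_one (norm_nonneg w) hw).comp h2).add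
      ((tendsto_pow_atTop_nhds_zero_of_lt_one hσ0.le hσ1).comp h2)
  obtain ⟨k, hk⟩ := (hlim.eventually (ge_mem_nhds (by norm_num : (0 : ℝ) + 0 < 1))).exists
  exact step k σ w hσ0 hσ1 hk

end Recurrence

/-! ### The map `z ↦ z + s / z` and the ellipses. -/

section Ellipse

/-- Every complex number is `z + s / z` for some `z` with `|z| ^ 2 ≥ |s|`. -/
theorem exists_eq_add_div {s : ℝ} (hs : s ≠ 0) (w : ℂ) :
    ∃ z : ℂ, z ≠ 0 ∧ w = z + s / z ∧ |s| ≤ ‖z‖ ^ 2 := by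
  -- A square root of the discriminant of `z ^ 2 - w z + s`; the root of larger modulus is taken.
  obtain ⟨d, hd⟩ := IsAlgClosed.exists_pow_nat_eq (w ^ 2 - 4 * s) two_pos
  have hprod : (w + d) / 2 * ((w - d) / 2) = s := by linear_combination -hd / 4
  have hs' : (s : ℂ) ≠ 0 := Complex.ofReal_ne_zero.2 hs
  have key : ∀ z z' : ℂ, z * z' = s → w = z + z' → ‖z'‖ ≤ ‖z‖ →
      ∃ z : ℂ, z ≠ 0 ∧ w = z + s / z ∧ |s| ≤ ‖z‖ ^ 2 := fun z z' h hsum hle => by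
    have hz : z ≠ 0 := fun h0 => hs' (by rw [← h, h0, zero_mul])
    refine ⟨z, hz, by rw [hsum, ← h, mul_div_cancel_left₀ _ hz], ?_⟩
    rw [← Real.norm_eq_abs, ← Complex.norm_real, ← h, norm_mul, sq]
    exact mul_le_mul_of_nonneg_left hle (norm_nonneg z)
  rcases le_total ‖(w - d) / 2‖ ‖(w + d) / 2‖ with h | h
  · exact key _ _ hprod (by ring) h
  · exact key _ _ (by rw [mul_comm, hprod]) (by ring) h

/-- With `ρ = |z| ^ 2`, both numerators factor alike: `(ρ ± s) ^ 2 - ρ (1 ± s) ^ 2 = (ρ - 1)(ρ - s ^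
2)`. The sign of `ρ - 1` thus decides on which side of the ellipse the image lies. -/
theorem ellipse_form_sub_one {s : ℝ} (hs : |s| < 1) {z : ℂ} (hz : z ≠ 0) :
    (z + s / z).re ^ 2 / (1 + s) ^ 2 + (z + s / z).im ^ 2 / (1 - s) ^ 2 - 1 =
      (‖z‖ ^ 2 - 1) * ((‖z‖ ^ 2 - s ^ 2) / (‖z‖ ^ 2) ^ 2 *
        (z.re ^ 2 / (1 + s) ^ 2 + z.im ^ 2 / (1 - s) ^ 2)) := by
  have h1 : 1 + s ≠ 0 := by linarith [(abs_lt.1 hs).1]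
  have h2 : 1 - s ≠ 0 := by linarith [(abs_lt.1 hs).2]
  have hρ : z.re ^ 2 + z.im ^ 2 ≠ 0 := by
    have := Complex.normSq_pos.2 hz
    rw [Complex.normSq_apply] at this
    nlinarith
  simp only [Complex.sq_norm, Complex.normSq_apply, Complex.add_re, Complex.add_im, Complex.div_re,
    Complex.div_im, Complex.ofReal_re, Complex.ofReal_im, zero_mul, zero_div, zero_sub, add_zero]
  simp only [← sq]
  field_simp
  ring

theorem ellipse_factor_pos {s : ℝ} (hs0 : s ≠ 0) (hs : |s| < 1) {z : ℂ} (hz : z ≠ 0)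
    (hsz : |s| ≤ ‖z‖ ^ 2) :
    0 < (‖z‖ ^ 2 - s ^ 2) / (‖z‖ ^ 2) ^ 2 *
        (z.re ^ 2 / (1 + s) ^ 2 + z.im ^ 2 / (1 - s) ^ 2) := by
  have h1 : 0 < 1 + s := by linarith [(abs_lt.1 hs).1]
  have h2 : 0 < 1 - s := by linarith [(abs_lt.1 hs).2]
  have hz' : 0 < ‖z‖ := norm_pos_iff.2 hz
  have h3 : 0 < ‖z‖ ^ 2 - s ^ 2 := by
    have := abs_pos.2 hs0
    rw [← sq_abs s]
    nlinarith
  refine mul_pos (by positivity) ?_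
  rcases eq_or_ne z.re 0 with h | h
  · have him : z.im ≠ 0 := fun h' => hz (Complex.ext h h')
    positivity
  · positivity

theorem one_le_norm_of_notMem_ellipse {s : ℝ} (hs0 : s ≠ 0) (hs : |s| < 1) {z : ℂ} (hz : z ≠ 0)
    (hsz : |s| ≤ ‖z‖ ^ 2) (h : z + s / z ∉ ellipse s) : 1 ≤ ‖z‖ := by
  have h1 := ellipse_form_sub_one hs hz
  have h2 := ellipse_factor_pos hs0 hs hz hsz
  simp only [ellipse, Set.mem_ofPred_eq, not_lt] at h
  by_contra! hlt
  have h3 : ‖z‖ ^ 2 < 1 := pow_lt_one₀ (norm_nonneg z) hlt two_ne_zero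
  have h4 := mul_neg_of_neg_of_pos (sub_neg.2 h3) h2
  linarith

theorem norm_eq_one_of_ellipse_form_eq_one {s : ℝ} (hs0 : s ≠ 0) (hs : |s| < 1) {z : ℂ}
    (hz : z ≠ 0) (hsz : |s| ≤ ‖z‖ ^ 2)
    (h : (z + s / z).re ^ 2 / (1 + s) ^ 2 + (z + s / z).im ^ 2 / (1 - s) ^ 2 = 1) : ‖z‖ = 1 := by
  have h1 := ellipse_form_sub_one hs hz
  have h2 := ellipse_factor_pos hs0 hs hz hsz
  rw [h, sub_self, eq_comm, mul_eq_zero, or_iff_left h2.ne', sub_eq_zero] at h1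
  exact (pow_eq_one_iff_of_nonneg (norm_nonneg z) two_ne_zero).1 h1

end Ellipse

/-! ### Gluing two half-line solutions. -/

section Eigenfunction

/-- `f` is a nonzero bounded solution on `ℤ` of the eigenvalue equation of `hoppingOperator c`. -/
def IsBoundedEigenfunction {σ : ℝ} (c : Omega σ) (w : ℂ) (f : ℤ → ℂ) : Prop :=
  (∃ M, ∀ n, ‖f n‖ ≤ M) ∧ f ≠ 0 ∧ ∀ n, ((c n : ℝ) : ℂ) * f (n - 1) + f (n + 1) = w * f n

theorem mem_pair_of_abs_eq {σ x : ℝ} (h : |x| = |σ|) : x ∈ ({σ, -σ} : Set ℝ) :=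
  abs_eq_abs.1 h

theorem zpow_eigen_equation {s : ℂ} {z : ℂ} (hz : z ≠ 0) (n : ℤ) :
    s * z ^ (n - 1) + z ^ (n + 1) = (z + s / z) * z ^ n := by
  rw [zpow_sub_one₀ hz, zpow_add_one₀ hz]
  field_simp
  ring

/-- A point on the boundary of an ellipse has a bounded eigenfunction for a constant sequence. -/
theorem exists_boundedEigenfunction_of_norm_eq_one {σ : ℝ} (s : ({σ, -σ} : Set ℝ)) {z : ℂ}
    (hz : ‖z‖ = 1) :
    IsBoundedEigenfunction (fun _ => s : Omega σ) (z + (s : ℝ) / z) fun n => z ^ n := by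
  have hz0 : z ≠ 0 := norm_ne_zero_iff.1 (by rw [hz]; exact one_ne_zero)
  refine ⟨⟨1, fun n => by rw [norm_zpow, hz, one_zpow]⟩, fun h => ?_, zpow_eigen_equation hz0⟩
  simpa using congr_fun h 0

/-- The solution that equals `z ^ n` for `n ≤ 1` and solves a recurrence for `n ≥ 2`. -/
def forwardSolution (w z : ℂ) (c : ℕ → ℝ) : ℕ → ℂ
  | 0 => 1
  | 1 => z
  | n + 2 => w * forwardSolution w z c (n + 1) - c n * forwardSolution w z c n

theorem exists_boundedEigenfunction {σ : ℝ} (hσ0 : 0 < σ) (hσ1 : σ < 1) {w : ℂ} (hw : ‖w‖ < 1)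
    (s : ({σ, -σ} : Set ℝ)) (hs : w ∉ ellipse s) :
    ∃ (c : Omega σ) (f : ℤ → ℂ), IsBoundedEigenfunction c w f := by
  have hsσ : |(s : ℝ)| = σ := (abs_entry (fun _ => s) 0).trans (abs_of_pos hσ0)
  have hs0 : (s : ℝ) ≠ 0 := abs_pos.1 (by rwa [hsσ])
  obtain ⟨z, hz, rfl, hsz⟩ := exists_eq_add_div hs0 w
  have hz1 := one_le_norm_of_notMem_ellipse hs0 (by rwa [hsσ]) hz hsz hs
  set w := z + (s : ℝ) / z
  obtain ⟨c, hc, hbdd⟩ := exists_bounded_recurrence hσ0 hσ1 hw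
  set g := forwardSolution w z c with hg
  obtain ⟨M, hM⟩ := hbdd g fun n => rfl
  have hc' : ∀ n, c n ∈ ({σ, -σ} : Set ℝ) := fun n =>
    mem_pair_of_abs_eq ((hc n).trans (abs_of_pos hσ0).symm)
  refine ⟨fun n => if 1 ≤ n then ⟨c (n - 1).toNat, hc' _⟩ else s,
    fun n => if 0 ≤ n then g n.toNat else z ^ n, ⟨max M 1, fun n => ?_⟩, fun h => ?_, fun n => ?_⟩
  · dsimp only
    split_ifs with h
    · exact (hM _).trans (le_max_left _ _)
    · refine le_trans ?_ (le_max_right _ _)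
      rw [norm_zpow]
      exact zpow_le_one_of_nonpos₀ hz1 (by omega)
  · simpa [hg, forwardSolution] using congr_fun h 0
  -- The two formulas agree at `0` and `1`, so the equation at `n = 0`, which involves the value at
  -- `1`, is still the one for powers of `z`.
  · have hzpow : ∀ n : ℤ, n ≤ 1 → (if 0 ≤ n then g n.toNat else z ^ n) = z ^ n := fun n hn => by
      split_ifs with h
      · obtain rfl | rfl : n = 0 ∨ n = 1 := by omega
        · simp [hg, forwardSolution]
        · simp [hg, forwardSolution]
      · rfl
    by_cases h1 : 1 ≤ n
    · obtain ⟨k, rfl⟩ : ∃ k : ℕ, n = k + 1 := ⟨(n - 1).toNat, by omega⟩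
      have e1 : ((k : ℤ) + 1 - 1).toNat = k := by omega
      have e2 : ((k : ℤ) + 1).toNat = k + 1 := by omega
      have e3 : ((k : ℤ) + 1 + 1).toNat = k + 2 := by omega
      simp only [h1, show (0 : ℤ) ≤ k + 1 - 1 by omega, show (0 : ℤ) ≤ k + 1 by omega,
        show (0 : ℤ) ≤ k + 1 + 1 by omega, if_true, e1, e2, e3]
      rw [show g (k + 2) = w * g (k + 1) - c k * g k from rfl]
      ring
    · dsimp only
      rw [if_neg h1, hzpow _ (by omega), hzpow _ (by omega), hzpow _ (by omega)]
      exact zpow_eigen_equation hz n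

end Eigenfunction

/-! ### Invertibility as a pair of lower bounds. -/

section BoundedBelow

/-- `A_c - w` is bounded below by `ε`. -/
def BoundedBelowBy {σ : ℝ} (c : Omega σ) (w : ℂ) (ε : ℝ) : Prop :=
  ∀ f : L2Z, ε * ‖f‖ ≤ ‖hoppingOperator c f - w • f‖

theorem memlp_reflect (f : L2Z) : Memℓp (fun n : ℤ => f (-n)) 2 := by
  have hp : 0 < (2 : ℝ≥0∞).toReal := by norm_num
  rw [memℓp_gen_iff hp]
  exact ((lp.memℓp f).summable hp).comp_injective neg_injective

/-- The reflection `f ↦ (n ↦ f (-n))` of a square-summable sequence. -/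
def reflect (f : L2Z) : L2Z := ⟨fun n => f (-n), memlp_reflect f⟩

@[simp]
theorem reflect_apply (f : L2Z) (n : ℤ) : reflect f n = f (-n) := rfl

theorem norm_reflect (f : L2Z) : ‖reflect f‖ = ‖f‖ := by
  have hp : 0 < (2 : ℝ≥0∞).toReal := by norm_num
  rw [lp.norm_eq_tsum_rpow hp, lp.norm_eq_tsum_rpow hp]
  congr 1
  exact (Equiv.neg ℤ).tsum_eq (fun n : ℤ => ‖f n‖ ^ (2 : ℝ≥0∞).toReal)

theorem reflect_reflect (f : L2Z) : reflect (reflect f) = f := by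
  ext n
  simp

theorem reflect_sub_smul (f g : L2Z) (w : ℂ) :
    reflect (f - w • g) = reflect f - w • reflect g := rfl

/-- The sequence whose operator is the reflection of the adjoint of `A_c`. -/
def dual {σ : ℝ} (c : Omega σ) : Omega σ := fun n => c (1 - n)

theorem PseudoErgodic.dual {σ : ℝ} {c : Omega σ} (hc : PseudoErgodic c) :
    PseudoErgodic (dual c) := by
  intro n b
  obtain ⟨m, hm⟩ := hc n (fun r => b r.rev)
  refine ⟨-m - n, fun r => ?_⟩
  have := hm r.rev
  rw [Fin.rev_rev] at this
  rw [← this, HoppingMatrix.dual]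
  congr 1
  rw [Fin.val_rev]
  omega

/-- Transposition exchanges the two shifts and reflection exchanges them back, so the adjoint is
again a hopping operator up to reflection. The entries are real, so no conjugate appears. -/
theorem inner_hoppingOperator_left {σ : ℝ} (c : Omega σ) (f g : L2Z) :
    inner ℂ (hoppingOperator c f) g =
      inner ℂ f (reflect (hoppingOperator (dual c) (reflect g))) := by
  set S : L2Z := ⟨_, memlp_weighted_shift c f⟩
  set T : L2Z := ⟨_, memlp_shift 1 f⟩
  have e1 : hoppingOperator c f = S + T := rfl
  set U : L2Z := ⟨_, memlp_weighted_shift (dual c) (reflect g)⟩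
  set V : L2Z := ⟨_, memlp_shift 1 (reflect g)⟩
  have e2 : reflect (hoppingOperator (dual c) (reflect g)) = reflect U + reflect V := rfl
  rw [e1, e2, inner_add_left, inner_add_right]
  congr 1
  · rw [lp.inner_eq_tsum, lp.inner_eq_tsum, ← (Equiv.addRight (1 : ℤ)).tsum_eq]
    refine tsum_congr fun n => ?_
    have h1 : S (n + 1) = ((c (n + 1) : ℝ) : ℂ) * f n := by
      change ((c (n + 1) : ℝ) : ℂ) * f (n + 1 - 1) = _
      rw [add_sub_cancel_right]
    have h2 : reflect U n = ((c (n + 1) : ℝ) : ℂ) * g (n + 1) := by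
      change ((c (1 - -n) : ℝ) : ℂ) * g (-(-n - 1)) = _
      rw [show 1 - -n = n + 1 by ring, show -(-n - 1) = n + 1 by ring]
    rw [Equiv.coe_addRight, h1, h2]
    simp only [RCLike.inner_apply, map_mul, Complex.conj_ofReal]
    ring
  · rw [lp.inner_eq_tsum, lp.inner_eq_tsum, ← (Equiv.addRight (-1 : ℤ)).tsum_eq]
    refine tsum_congr fun n => ?_
    have h1 : T (n + -1) = f n := by
      change f (n + -1 + 1) = _
      rw [neg_add_cancel_right]
    have h2 : reflect V n = g (n + -1) := by
      change g (-(-n + 1)) = _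
      rw [show -(-n + 1) = n + -1 by ring]
    rw [Equiv.coe_addRight, h1, h2]

theorem adjoint_hoppingOperator_apply {σ : ℝ} (c : Omega σ) (g : L2Z) :
    ContinuousLinearMap.adjoint (hoppingOperator c) g =
      reflect (hoppingOperator (dual c) (reflect g)) := by
  refine ext_inner_left ℂ fun f => ?_
  rw [ContinuousLinearMap.adjoint_inner_right, inner_hoppingOperator_left]

theorem exists_bound_of_isUnit {T : L2Z →L[ℂ] L2Z} (hT : IsUnit T) :
    ∃ ε > 0, ∀ f, ε * ‖f‖ ≤ ‖T f‖ := by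
  obtain ⟨u, rfl⟩ := hT
  refine ⟨(‖(↑u⁻¹ : L2Z →L[ℂ] L2Z)‖ + 1)⁻¹, by positivity, fun f => ?_⟩
  rw [inv_mul_le_iff₀ (by positivity)]
  have h : (↑u⁻¹ : L2Z →L[ℂ] L2Z) ((u : L2Z →L[ℂ] L2Z) f) = f := by
    rw [← mul_apply_eq_comp, Units.inv_mul, one_apply_eq_self]
  calc ‖f‖ = ‖(↑u⁻¹ : L2Z →L[ℂ] L2Z) ((u : L2Z →L[ℂ] L2Z) f)‖ := by rw [h]
    _ ≤ ‖(↑u⁻¹ : L2Z →L[ℂ] L2Z)‖ * ‖(u : L2Z →L[ℂ] L2Z) f‖ := ContinuousLinearMap.le_opNorm _ _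
    _ ≤ _ := by gcongr; linarith

/-- The first bound gives injectivity and closed range; the second makes the kernel of the adjoint,
the orthogonal complement of the range, trivial. -/
theorem isUnit_of_bounds {T : L2Z →L[ℂ] L2Z} {ε δ : ℝ} (hε : 0 < ε) (hδ : 0 < δ)
    (h1 : ∀ f, ε * ‖f‖ ≤ ‖T f‖) (h2 : ∀ f, δ * ‖f‖ ≤ ‖ContinuousLinearMap.adjoint T f‖) :
    IsUnit T := by
  have hanti : AntilipschitzWith (Real.toNNReal ε⁻¹) T := by
    refine AddMonoidHomClass.antilipschitz_of_bound T fun f => ?_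
    rw [Real.coe_toNNReal _ (by positivity), ← div_eq_inv_mul, le_div_iff₀' hε]
    exact h1 f
  rw [ContinuousLinearMap.isUnit_iff_bijective]
  refine ⟨hanti.injective, ?_⟩
  have hclosed : IsClosed (T.range : Set L2Z) := by
    rw [LinearMap.coe_range]
    exact hanti.isClosed_range T.uniformContinuous
  have hker : (ContinuousLinearMap.adjoint T).ker = ⊥ := by
    rw [LinearMap.ker_eq_bot']
    intro f hf
    have := h2 f
    rw [show ContinuousLinearMap.adjoint T f = 0 from hf, norm_zero] at this
    exact norm_le_zero_iff.1 (nonpos_of_mul_nonpos_right this hδ)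
  have htop : T.range.topologicalClosure = ⊤ := by
    rw [Submodule.topologicalClosure_eq_top_iff, ContinuousLinearMap.orthogonal_range, hker]
  rw [hclosed.submodule_topologicalClosure_eq] at htop
  exact LinearMap.range_eq_top.1 htop

theorem notMem_spec_iff {σ : ℝ} (c : Omega σ) (w : ℂ) :
    w ∉ spec c ↔ (∃ ε > 0, BoundedBelowBy c w ε) ∧
      ∃ ε > 0, BoundedBelowBy (dual c) (starRingEnd ℂ w) ε := by
  have hT : ∀ f, ‖(algebraMap ℂ (L2Z →L[ℂ] L2Z) w - hoppingOperator c) f‖ =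
      ‖hoppingOperator c f - w • f‖ := fun f => by
    rw [norm_sub_rev]
    simp [Algebra.algebraMap_eq_smul_one]
  have hT' : ∀ f, ‖ContinuousLinearMap.adjoint
      (algebraMap ℂ (L2Z →L[ℂ] L2Z) w - hoppingOperator c) f‖ =
      ‖hoppingOperator (dual c) (reflect f) - starRingEnd ℂ w • reflect f‖ := fun f => by
    have h : ContinuousLinearMap.adjoint (algebraMap ℂ (L2Z →L[ℂ] L2Z) w - hoppingOperator c) f =
        starRingEnd ℂ w • f - ContinuousLinearMap.adjoint (hoppingOperator c) f := by
      rw [map_sub, Algebra.algebraMap_eq_smul_one, LinearIsometryEquiv.map_smulₛₗ]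
      simp [← ContinuousLinearMap.star_eq_adjoint]
    rw [h, norm_sub_rev, ← norm_reflect, reflect_sub_smul, adjoint_hoppingOperator_apply,
      reflect_reflect]
  rw [spec, spectrum.mem_iff, not_not]
  constructor
  · intro h
    obtain ⟨ε, hε, h1⟩ := exists_bound_of_isUnit h
    obtain ⟨δ, hδ, h2⟩ := exists_bound_of_isUnit h.star
    refine ⟨⟨ε, hε, fun f => hT f ▸ h1 f⟩, δ, hδ, fun f => ?_⟩
    have := h2 (reflect f)
    rwa [ContinuousLinearMap.star_eq_adjoint, hT', reflect_reflect, norm_reflect] at this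
  · rintro ⟨⟨ε, hε, h1⟩, δ, hδ, h2⟩
    refine isUnit_of_bounds hε hδ (fun f => hT f ▸ h1 f) fun f => ?_
    rw [hT', ← norm_reflect]
    exact h2 _

end BoundedBelow

/-! ### Spectral inclusion, and bounded eigenfunctions as spectral points. -/

section Truncation

/-- The restriction of a sequence to the finite set `s`, as a square-summable sequence. -/
def truncate (s : Finset ℤ) (f : ℤ → ℂ) : L2Z :=
  ⟨fun n => if n ∈ s then f n else 0, by
    refine memℓp_gen (summable_of_ne_finset_zero (s := s) fun n hn => ?_)
    rw [if_neg hn, norm_zero, Real.zero_rpow (by norm_num)]⟩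

theorem truncate_apply (s : Finset ℤ) (f : ℤ → ℂ) (n : ℤ) :
    truncate s f n = if n ∈ s then f n else 0 := rfl

theorem norm_sq_eq_tsum (f : L2Z) : ‖f‖ ^ 2 = ∑' n, ‖f n‖ ^ 2 := by
  have := lp.norm_rpow_eq_tsum (p := 2) (by norm_num) f
  simpa using this

theorem norm_sq_eq_sum {f : L2Z} {s : Finset ℤ} (h : ∀ n ∉ s, f n = 0) :
    ‖f‖ ^ 2 = ∑ n ∈ s, ‖f n‖ ^ 2 := by
  rw [norm_sq_eq_tsum, tsum_eq_sum fun n hn => ?_]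
  rw [h n hn, norm_zero, zero_pow two_ne_zero]

theorem tendsto_truncate (f : L2Z) :
    Tendsto (fun N : ℕ => truncate (Finset.Icc (-N : ℤ) N) f) atTop (𝓝 f) := by
  have h1 : ∀ s : Finset ℤ, ∑ n ∈ s, lp.single 2 n (f n) = truncate s f := fun s => by
    ext k
    rw [lp.coeFn_sum, Finset.sum_apply, truncate_apply]
    simp [lp.single_apply, Pi.single_apply]
  have h2 : Tendsto (fun s : Finset ℤ => truncate s f) atTop (𝓝 f) := by
    have := lp.hasSum_single (p := 2) (by norm_num) f
    simp only [HasSum, h1] at this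
    simpa using this
  refine h2.comp (tendsto_atTop_finset_of_monotone ?_ ?_)
  · intro a b hab
    exact Finset.Icc_subset_Icc (by omega) (by omega)
  · intro n
    exact ⟨n.natAbs, by rw [Finset.mem_Icc]; omega⟩

/-- Lower bounds are inherited by every sequence whose finite blocks all occur in `c`. -/
theorem BoundedBelowBy.of_pseudoErgodic {σ : ℝ} {c : Omega σ} (hc : PseudoErgodic c) {w : ℂ}
    {ε : ℝ} (h : BoundedBelowBy c w ε) (d : Omega σ) : BoundedBelowBy d w ε := by
  intro f
  have hfin : ∀ N : ℕ, ε * ‖truncate (Finset.Icc (-N : ℤ) N) f‖ ≤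
      ‖hoppingOperator d (truncate (Finset.Icc (-N : ℤ) N) f) -
        w • truncate (Finset.Icc (-N : ℤ) N) f‖ := by
    intro N
    set g := truncate (Finset.Icc (-N : ℤ) N) f with hg
    have hg0 : ∀ n : ℤ, n < -N ∨ N < n → g n = 0 := fun n hn => by
      rw [hg, truncate_apply, if_neg]
      rw [Finset.mem_Icc]
      omega
    -- The window `[-N - 1, N + 1]` covers every coefficient of `d` that meets the support of `g`;
    -- translating `g` moves it onto a copy of this block in `c`.
    obtain ⟨m, hm⟩ := hc (2 * N + 3) fun r => d (-N - 1 + (r : ℕ))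
    set k : ℤ := -(m + 1 + N + 1) with hk
    have hcd : ∀ n : ℤ, -N - 1 ≤ n → n ≤ N + 1 → c (n - k) = d n := fun n h1 h2 => by
      have := hm ⟨(n + N + 1).toNat, by omega⟩
      have e : ((n + N + 1).toNat : ℤ) = n + N + 1 := Int.toNat_of_nonneg (by omega)
      simp only [e] at this
      rw [show n - k = m + (n + N + 1 + 1) by rw [hk]; ring, this]
      congr 1
      ring
    set S : L2Z → L2Z := fun u => ⟨_, memlp_shift k u⟩ with hS
    have hShift : hoppingOperator c (S g) - w • S g = S (hoppingOperator d g - w • g) := by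
      ext n
      change ((c n : ℝ) : ℂ) * g (n - 1 + k) + g (n + 1 + k) - w * g (n + k) =
        ((d (n + k) : ℝ) : ℂ) * g (n + k - 1) + g (n + k + 1) - w * g (n + k)
      rw [show n - 1 + k = n + k - 1 by ring, show n + 1 + k = n + k + 1 by ring]
      by_cases hn : -(N : ℤ) - 1 ≤ n + k ∧ n + k ≤ N + 1
      · rw [← hcd _ hn.1 hn.2, add_sub_cancel_right]
      · rw [hg0 (n + k - 1) (by omega), mul_zero, mul_zero]
    have := h (S g)
    rwa [hShift, hS, norm_shift, norm_shift] at this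
  have hlim := tendsto_truncate f
  have hcont : Continuous fun g : L2Z => ‖hoppingOperator d g - w • g‖ := by fun_prop
  exact le_of_tendsto_of_tendsto' (hlim.norm.const_mul ε) ((hcont.tendsto f).comp hlim) hfin

theorem spec_subset_of_pseudoErgodic {σ : ℝ} {c : Omega σ} (hc : PseudoErgodic c) (d : Omega σ) :
    spec d ⊆ spec c := by
  intro w
  contrapose
  rw [notMem_spec_iff, notMem_spec_iff]
  rintro ⟨⟨ε, hε, h1⟩, δ, hδ, h2⟩
  exact ⟨⟨ε, hε, h1.of_pseudoErgodic hc d⟩, δ, hδ, h2.of_pseudoErgodic hc.dual _⟩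

theorem spec_eq_commonSpectrum {σ : ℝ} {c : Omega σ} (hc : PseudoErgodic c) :
    spec c = commonSpectrum σ :=
  (Set.subset_iInter₂ fun _ hd => spec_subset_of_pseudoErgodic hd c).antisymm
    (Set.iInter₂_subset c hc)

theorem spec_subset_commonSpectrum {σ : ℝ} (d : Omega σ) : spec d ⊆ commonSpectrum σ :=
  Set.subset_iInter₂ fun _ hc => spec_subset_of_pseudoErgodic hc d

theorem isClosed_commonSpectrum (σ : ℝ) : IsClosed (commonSpectrum σ) :=
  isClosed_iInter fun _ => isClosed_iInter fun _ => spectrum.isClosed _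

/-- Truncating `f` spoils the equation only near the two cut points, with an error bounded
independently of `N`. A lower bound would then force `f` into `ℓ²`, where it is a genuine
eigenvector and contradicts that same bound. -/
theorem IsBoundedEigenfunction.mem_spec {σ : ℝ} {c : Omega σ} {w : ℂ} {f : ℤ → ℂ}
    (h : IsBoundedEigenfunction c w f) : w ∈ spec c := by
  by_contra hw
  obtain ⟨⟨ε, hε, hb⟩, -⟩ := (notMem_spec_iff c w).1 hw
  obtain ⟨⟨M, hM⟩, hf0, hf⟩ := h
  have hM0 : 0 ≤ M := (norm_nonneg _).trans (hM 0)
  -- At most four sites carry an error, each of modulus at most `(|σ| + 1 + |w|) M`.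
  set K : ℝ := 4 * ((|σ| + 1 + ‖w‖) * M) ^ 2 with hK
  have hbound : ∀ N : ℕ, ε ^ 2 * ∑ n ∈ Finset.Icc (-N : ℤ) N, ‖f n‖ ^ 2 ≤ K := by
    intro N
    set g := truncate (Finset.Icc (-N : ℤ) N) f with hg
    have hgi : ∀ n : ℤ, -N ≤ n → n ≤ N → g n = f n := fun n h1 h2 => by
      rw [hg, truncate_apply, if_pos (Finset.mem_Icc.2 ⟨h1, h2⟩)]
    have hgo : ∀ n : ℤ, n < -N ∨ N < n → g n = 0 := fun n hn => by
      rw [hg, truncate_apply, if_neg]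
      rw [Finset.mem_Icc]
      omega
    have hgM : ∀ n, ‖g n‖ ≤ M := fun n => by
      rw [hg, truncate_apply]
      split_ifs
      · exact hM n
      · rwa [norm_zero]
    have hnorm : ∑ n ∈ Finset.Icc (-N : ℤ) N, ‖f n‖ ^ 2 = ‖g‖ ^ 2 := by
      rw [norm_sq_eq_sum (s := Finset.Icc (-N : ℤ) N) fun n hn => by
        rw [hg, truncate_apply, if_neg hn]]
      refine Finset.sum_congr rfl fun n hn => ?_
      rw [hg, truncate_apply, if_pos hn]
    set e := hoppingOperator c g - w • g
    have he_apply : ∀ n, e n = ((c n : ℝ) : ℂ) * g (n - 1) + g (n + 1) - w * g n := fun n => rfl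
    have he0 : ∀ n ∉ ({-(N : ℤ) - 1, -(N : ℤ), (N : ℤ), (N : ℤ) + 1} : Finset ℤ), e n = 0 := fun n hn => by
      simp only [Finset.mem_insert, Finset.mem_singleton, not_or] at hn
      rw [he_apply]
      by_cases hin : -(N : ℤ) < n ∧ n < N
      · rw [hgi _ (by omega) (by omega), hgi _ (by omega) (by omega),
          hgi _ (by omega) (by omega), hf, sub_self]
      · rw [hgo _ (by omega), hgo _ (by omega), hgo _ (by omega)]
        ring
    have heM : ∀ n, ‖e n‖ ≤ (|σ| + 1 + ‖w‖) * M := fun n => by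
      rw [he_apply]
      calc _ ≤ ‖((c n : ℝ) : ℂ) * g (n - 1)‖ + ‖g (n + 1)‖ + ‖w * g n‖ :=
            (norm_sub_le _ _).trans (by gcongr; exact norm_add_le _ _)
        _ ≤ |σ| * M + M + ‖w‖ * M := by
            rw [norm_mul, norm_mul, Complex.norm_real, Real.norm_eq_abs, abs_entry]
            gcongr <;> exact hgM _
        _ = _ := by ring
    rw [hnorm, ← mul_pow]
    calc (ε * ‖g‖) ^ 2 ≤ ‖e‖ ^ 2 := by gcongr; exact hb g
      _ = ∑ n ∈ ({-(N : ℤ) - 1, -(N : ℤ), (N : ℤ), (N : ℤ) + 1} : Finset ℤ), ‖e n‖ ^ 2 := norm_sq_eq_sum he0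
      _ ≤ ∑ n ∈ ({-(N : ℤ) - 1, -(N : ℤ), (N : ℤ), (N : ℤ) + 1} : Finset ℤ), ((|σ| + 1 + ‖w‖) * M) ^ 2 := by
          gcongr with n
          exact heM n
      _ ≤ K := by
          rw [Finset.sum_const, nsmul_eq_mul, hK]
          gcongr
          exact_mod_cast Finset.card_le_four
  have hsum : Summable fun n => ‖f n‖ ^ 2 := by
    refine summable_of_sum_le (c := K / ε ^ 2) (fun n => by positivity) fun s => ?_
    obtain ⟨N, hN⟩ : ∃ N : ℕ, s ⊆ Finset.Icc (-N : ℤ) N := by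
      refine ⟨s.sup Int.natAbs, fun n hn => ?_⟩
      have := Finset.le_sup (f := Int.natAbs) hn
      rw [Finset.mem_Icc]
      omega
    rw [le_div_iff₀' (by positivity)]
    refine le_trans ?_ (hbound N)
    gcongr
  have hmem : Memℓp f 2 := memℓp_gen (by simpa using hsum)
  have := hb ⟨f, hmem⟩
  rw [show hoppingOperator c ⟨f, hmem⟩ - w • ⟨f, hmem⟩ = 0 by
    ext n
    exact sub_eq_zero.2 (hf n), norm_zero] at this
  have h0 : (⟨f, hmem⟩ : L2Z) = 0 := norm_le_zero_iff.1 (nonpos_of_mul_nonpos_right this hε)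
  exact hf0 (congr_arg (fun u : L2Z => (u : ℤ → ℂ)) h0)

theorem mem_commonSpectrum_of_notMem_ellipse {σ : ℝ} (hσ0 : 0 < σ) (hσ1 : σ < 1)
    (s : ({σ, -σ} : Set ℝ)) {w : ℂ} (hw : ‖w‖ ≤ 1) (hs : w ∉ ellipse s) :
    w ∈ commonSpectrum σ := by
  have hsσ : |(s : ℝ)| = σ := (abs_entry (fun _ => s) 0).trans (abs_of_pos hσ0)
  have hs0 : (s : ℝ) ≠ 0 := abs_pos.1 (by rwa [hsσ])
  set q : ℂ → ℝ := fun w => w.re ^ 2 / (1 + (s : ℝ)) ^ 2 + w.im ^ 2 / (1 - (s : ℝ)) ^ 2 with hq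
  have hlt : ∀ w : ℂ, ‖w‖ < 1 → 1 ≤ q w → w ∈ commonSpectrum σ := fun w hw hqw => by
    obtain ⟨c, f, hf⟩ := exists_boundedEigenfunction hσ0 hσ1 hw s (not_lt.2 hqw)
    exact spec_subset_commonSpectrum c hf.mem_spec
  have hqw : 1 ≤ q w := not_lt.1 hs
  rcases hqw.eq_or_lt' with h1 | h1
  -- On the ellipse itself, shrinking `w` would enter the ellipse, so a constant sequence is used.
  -- Strictly outside, `r w` with `r` slightly below `1` stays outside and has modulus below `1`.
  · obtain ⟨z, hz, rfl, hsz⟩ := exists_eq_add_div hs0 w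
    have hz1 := norm_eq_one_of_ellipse_form_eq_one hs0 (by rwa [hsσ]) hz hsz h1
    exact spec_subset_commonSpectrum _ (exists_boundedEigenfunction_of_norm_eq_one s hz1).mem_spec
  · have hr : Tendsto (fun r : ℝ => (r : ℂ) * w) (𝓝[<] 1) (𝓝 w) := by
      have : Continuous fun r : ℝ => (r : ℂ) * w := by fun_prop
      simpa using (this.tendsto 1).mono_left nhdsWithin_le_nhds
    have hqc : Continuous q := by fun_prop
    refine (isClosed_commonSpectrum σ).mem_of_tendsto hr ?_
    filter_upwards [((hqc.tendsto w).comp hr).eventually (lt_mem_nhds h1), self_mem_nhdsWithin,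
      mem_nhdsWithin_of_mem_nhds (lt_mem_nhds zero_lt_one)] with r hr1 hr2 hr3
    refine hlt _ ?_ hr1.le
    rw [norm_mul, Complex.norm_real, Real.norm_eq_abs, abs_of_pos hr3]
    exact (mul_le_of_le_one_right hr3.le hw).trans_lt hr2

end Truncation

/-! ### Almost sure pseudo-ergodicity. -/

section Probability

theorem entryLaw_singleton_ne_zero {σ p : ℝ} (h0 : 0 < p) (h1 : p < 1) (x : ({σ, -σ} : Set ℝ)) :
    entryLaw σ p {x} ≠ 0 := by
  have hp : ENNReal.ofReal p ≠ 0 := by simpa using h0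
  have hp' : ENNReal.ofReal (1 - p) ≠ 0 := by simpa using h1
  rw [entryLaw, Measure.add_apply, Measure.smul_apply, Measure.smul_apply]
  obtain ⟨x, rfl | rfl⟩ := x
  · simp [hp]
  · simp [hp']

/-- The event that the block `b` occurs in `c` at the `k`-th of consecutive disjoint windows. -/
def blockEvent {σ : ℝ} {n : ℕ} (b : Fin n → ({σ, -σ} : Set ℝ)) (k : ℕ) : Set (Omega σ) :=
  {c | ∀ r : Fin n, c ((k * n : ℕ) + ((r : ℕ) + 1)) = b r}

theorem window_injective (n : ℕ) :
    Function.Injective fun x : ℕ × Fin n => (((x.1 * n : ℕ) : ℤ) + (((x.2 : ℕ) : ℤ) + 1)) := by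
  rintro ⟨k, r⟩ ⟨l, t⟩ h
  have h' : k * n + r = l * n + t := by
    dsimp only at h
    omega
  have hn : 0 < n := r.pos
  have hr := congr_arg (· % n) h'
  have hk := congr_arg (· / n) h'
  simp only [Nat.mul_add_mod_self_right, Nat.mod_eq_of_lt r.2, Nat.mod_eq_of_lt t.2] at hr
  simp only [Nat.mul_comm _ n, Nat.mul_add_div hn, Nat.div_eq_of_lt r.2, Nat.div_eq_of_lt t.2,
    add_zero] at hk
  exact Prod.ext hk (Fin.ext hr)

theorem sequenceLaw_biInter_blockEvent {σ p : ℝ} (h0 : 0 < p) (h1 : p < 1) {n : ℕ}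
    (b : Fin n → ({σ, -σ} : Set ℝ)) (s : Finset ℕ) :
    sequenceLaw σ p (⋂ k ∈ s, blockEvent b k) = ∏ _k ∈ s, ∏ r, entryLaw σ p {b r} := by
  have : IsProbabilityMeasure (entryLaw σ p) := isProbabilityMeasure_entryLaw h0.le h1.le
  set φ : ℕ × Fin n → ℤ := fun x => ((x.1 * n : ℕ) : ℤ) + (((x.2 : ℕ) : ℤ) + 1) with hφ
  have hinj : Function.Injective φ := window_injective n
  set t : ℤ → Set ({σ, -σ} : Set ℝ) := fun i => {x | ∀ y, φ y = i → x = b y.2} with ht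
  have htφ : ∀ y, t (φ y) = {b y.2} := fun y => by
    ext x
    simp only [ht, Set.mem_ofPred_eq, Set.mem_singleton_iff]
    refine ⟨fun h => h y rfl, ?_⟩
    rintro rfl y' hy'
    rw [hinj hy']
  have hset : ⋂ k ∈ s, blockEvent b k =
      Set.pi (((s ×ˢ Finset.univ).map ⟨φ, hinj⟩ : Finset ℤ) : Set ℤ) t := by
    ext c
    simp only [Set.mem_iInter, blockEvent, Set.mem_ofPred_eq, Set.mem_pi, Finset.mem_coe,
      Finset.mem_map, Finset.mem_product, Finset.mem_univ, and_true, Function.Embedding.coeFn_mk]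
    constructor
    · rintro h _ ⟨y, hy, rfl⟩
      rw [htφ]
      exact h y.1 hy y.2
    · intro h k hk r
      have := h (φ (k, r)) ⟨(k, r), hk, rfl⟩
      rwa [htφ] at this
  rw [hset, sequenceLaw, Measure.infinitePi_pi _ fun i _ => (Set.toFinite _).measurableSet,
    Finset.prod_map, Finset.prod_product]
  simp only [Function.Embedding.coeFn_mk, htφ]

theorem measurableSet_blockEvent {σ : ℝ} {n : ℕ} (b : Fin n → ({σ, -σ} : Set ℝ)) (k : ℕ) :
    MeasurableSet (blockEvent b k) := by
  rw [blockEvent, Set.ofPred_forall]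
  refine MeasurableSet.iInter fun r => ?_
  have h : Measurable fun c : Omega σ => c ((k * n : ℕ) + ((r : ℕ) + 1)) := measurable_pi_apply _
  exact h (measurableSet_singleton (b r))

/-- For each of the countably many blocks, its occurrences in disjoint windows are independent
events of equal positive probability, so by Borel–Cantelli infinitely many happen almost surely. -/
theorem ae_pseudoErgodic {σ p : ℝ} (h0 : 0 < p) (h1 : p < 1) :
    ∀ᵐ c ∂(sequenceLaw σ p), PseudoErgodic c := by
  have : IsProbabilityMeasure (entryLaw σ p) := isProbabilityMeasure_entryLaw h0.le h1.le
  have : IsProbabilityMeasure (sequenceLaw σ p) := by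
    unfold sequenceLaw
    infer_instance
  have : Finite ({σ, -σ} : Set ℝ) := Set.toFinite _
  refine ae_all_iff.2 fun n => ae_all_iff.2 fun b => ?_
  have hsingle : ∀ k, sequenceLaw σ p (blockEvent b k) = ∏ r, entryLaw σ p {b r} := fun k => by
    simpa using sequenceLaw_biInter_blockEvent h0 h1 b {k}
  have hlim := ProbabilityTheory.measure_limsup_eq_one (measurableSet_blockEvent b)
    ((ProbabilityTheory.iIndepSet_iff_meas_biInter (μ := sequenceLaw σ p)
      (measurableSet_blockEvent b)).2 fun s => by
        rw [sequenceLaw_biInter_blockEvent h0 h1]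
        simp only [hsingle])
    (by
      simp only [hsingle]
      exact ENNReal.tsum_const_eq_top_of_ne_zero
        (Finset.prod_ne_zero_iff.2 fun r _ => entryLaw_singleton_ne_zero h0 h1 _))
  have hae : ∀ᵐ c ∂(sequenceLaw σ p), c ∈ limsup (blockEvent b) atTop :=
    (mem_ae_iff_prob_eq_one (MeasurableSet.measurableSet_limsup (measurableSet_blockEvent b))).2 hlim
  filter_upwards [hae] with c hc
  rw [mem_limsup_iff_frequently_mem] at hc
  obtain ⟨k, hk⟩ := hc.exists
  exact ⟨(k * n : ℕ), hk⟩

theorem exists_pseudoErgodic (σ : ℝ) : ∃ c : Omega σ, PseudoErgodic c := by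
  have : IsProbabilityMeasure (entryLaw σ (1 / 2)) :=
    isProbabilityMeasure_entryLaw (by norm_num) (by norm_num)
  have : IsProbabilityMeasure (sequenceLaw σ (1 / 2)) := by
    unfold sequenceLaw
    infer_instance
  exact (ae_pseudoErgodic (σ := σ) (p := 1 / 2) (by norm_num) (by norm_num)).exists

end Probability

end HoppingMatrix

end

theorem mainTheorem1 (σ : ℝ) (hσ0 : 0 < σ) (hσ1 : σ < 1) :
    (∃ c : HoppingMatrix.Omega σ, HoppingMatrix.PseudoErgodic c) ∧
    (∀ c : HoppingMatrix.Omega σ, HoppingMatrix.PseudoErgodic c →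
      HoppingMatrix.spec c = HoppingMatrix.commonSpectrum σ) ∧
    (∀ p : ℝ, 0 < p → p < 1 → ∀ᵐ c ∂(HoppingMatrix.sequenceLaw σ p),
      HoppingMatrix.PseudoErgodic c ∧ HoppingMatrix.spec c = HoppingMatrix.commonSpectrum σ) ∧
    {z : ℂ | ‖z‖ ≤ 1} \ HoppingMatrix.hole σ ⊆ HoppingMatrix.commonSpectrum σ := by
  refine ⟨HoppingMatrix.exists_pseudoErgodic σ,
    fun c hc => HoppingMatrix.spec_eq_commonSpectrum hc, fun p h0 h1 => ?_, ?_⟩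
  · filter_upwards [HoppingMatrix.ae_pseudoErgodic h0 h1] with c hc
    exact ⟨hc, HoppingMatrix.spec_eq_commonSpectrum hc⟩
  · rintro w ⟨hw, hhole⟩
    rcases not_and_or.1 hhole with h | h
    · exact HoppingMatrix.mem_commonSpectrum_of_notMem_ellipse hσ0 hσ1 ⟨σ, Or.inl rfl⟩ hw h
    · exact HoppingMatrix.mem_commonSpectrum_of_notMem_ellipse hσ0 hσ1 ⟨-σ, Or.inr rfl⟩ hw h
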